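/- Theorem 3.3. Graphs are finite, undirected and simple; $N(x)$ denotes the set of neighbors of a vertex $x$. A set $S$ of vertices of a graph $G$ is called a $q$-set if $|S|\ge 2$ and for every $u\in S$ there is $v\in S$, $v\ne u$, with $N(u)\cap N(v)\ne\emptyset$. The graph $G$ is called s-quadrangular if $$\Bigl|\bigcup_{u,v\in S,\ u\neq v}\bigl(N(u)\cap N(v)\bigr)\Bigr|\ \ge\ |S|$$ for every $q$-set $S$ of $G$; equivalently, its complete biorientation (the digraph obtained by replacing every edge $xy$ by the two arcs $xy$ and $yx$) is an s-quadrangular digraph, meaning that the condition above holds both with all neighborhoods replaced by out-neighborhoods $N^+$ and with all neighborhoods replaced by in-neighborhoods $N^-$. Every connected s-quadrangular graph $G$ with at least three vertices has a 2-factor, that is, a spanning subgraph $H$ of $G$ in which every vertex has degree exactly $2$. -/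

import Mathlib

namespace Digraph

variable {V : Type*}

/-- The set `N⁺(x)` of out-neighbors of `x`. -/
def outNbrs (D : Digraph V) (x : V) : Set V := {y | D.Adj x y}

/-- The set `N⁻(x)` of in-neighbors of `x`. -/
def inNbrs (D : Digraph V) (x : V) : Set V := {y | D.Adj y x}

/-- `S` is a `q⁺`-set: it has at least two vertices, and every `u ∈ S` has a common
out-neighbor with some other vertex `v ∈ S`. -/
def IsQPlusSet (D : Digraph V) (S : Set V) : Prop :=
  2 ≤ S.encard ∧ ∀ u ∈ S, ∃ v ∈ S, v ≠ u ∧ (D.outNbrs u ∩ D.outNbrs v).Nonempty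

/-- `S` is a `q⁻`-set: it has at least two vertices, and every `u ∈ S` has a common
in-neighbor with some other vertex `v ∈ S`. -/
def IsQMinusSet (D : Digraph V) (S : Set V) : Prop :=
  2 ≤ S.encard ∧ ∀ u ∈ S, ∃ v ∈ S, v ≠ u ∧ (D.inNbrs u ∩ D.inNbrs v).Nonempty

/-- The union of the sets `N⁺(u) ∩ N⁺(v)` over distinct `u, v ∈ S`. -/
def commonOut (D : Digraph V) (S : Set V) : Set V :=
  {w | ∃ u ∈ S, ∃ v ∈ S, u ≠ v ∧ w ∈ D.outNbrs u ∩ D.outNbrs v}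

/-- The union of the sets `N⁻(u) ∩ N⁻(v)` over distinct `u, v ∈ S`. -/
def commonIn (D : Digraph V) (S : Set V) : Set V :=
  {w | ∃ u ∈ S, ∃ v ∈ S, u ≠ v ∧ w ∈ D.inNbrs u ∩ D.inNbrs v}

/-- A digraph is s-quadrangular if `|⋃ {N⁺(u) ∩ N⁺(v) : u ≠ v ∈ S}| ≥ |S|` for every `q⁺`-set `S`
and `|⋃ {N⁻(u) ∩ N⁻(v) : u ≠ v ∈ S}| ≥ |S|` for every `q⁻`-set `S`. -/
def IsSQuadrangular (D : Digraph V) : Prop :=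
  (∀ S : Set V, D.IsQPlusSet S → S.encard ≤ (D.commonOut S).encard) ∧
  (∀ S : Set V, D.IsQMinusSet S → S.encard ≤ (D.commonIn S).encard)

end Digraph

namespace SimpleGraph

variable {V : Type*}

/-- The complete biorientation of `G`: every edge `xy` is replaced by the two arcs `xy`, `yx`. -/
def completeBiorientation (G : SimpleGraph V) : Digraph V where
  Adj x y := G.Adj x y

/-- A graph is s-quadrangular if its complete biorientation is. -/
def IsSQuadrangular (G : SimpleGraph V) : Prop :=
  G.completeBiorientation.IsSQuadrangular

/-- `H` is an `f`-factor of `G`: a spanning subgraph in which every vertex `x` has degree `f x`. -/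
def IsFactor {G : SimpleGraph V} (H : G.Subgraph) (f : V → ℕ) : Prop :=
  H.IsSpanning ∧ ∀ x : V, (H.neighborSet x).encard = f x

/-- `H` is a 2-factor of `G`: an `f`-factor with `f` constantly `2`. -/
def IsTwoFactor {G : SimpleGraph V} (H : G.Subgraph) : Prop :=
  IsFactor H (fun _ => 2)

end SimpleGraph

/-! A perfect matching of `twoFactorGadget` yields a 2-factor: an edge lies in the factor when its
two darts are matched to vertex copies instead of to each other. If there is no 2-factor, Tutte's
theorem gives a barrier, and a smallest one consists of both copies of a set S and all darts leaving
an independent set T (`exists_gadget_barrier`).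

Let M be the set of shared vertices, and split the private vertices of T into X (with an outer path)
and Y (without). Counting odd members with parity gives |S| + |M| + |X| < |T| (`exists_barrier`).
Private vertices lie in no q-set inside T, so the quadrangular inequality is instead applied within
T ∪ N(Y). This gives |T| ≤ |S| + |M| + |X| (`card_le_of_commonNeighbors`), a contradiction. -/

namespace SimpleGraph

variable {V : Type*}

/-! ### Reduction of 2-factors to perfect matchings -/

/-- The gadget graph whose perfect matchings encode the 2-factors of `G`: every vertex of `G` has
two copies, each joined to all darts leaving that vertex, and every dart is joined to its reverse. -/
def twoFactorGadget (G : SimpleGraph V) : SimpleGraph ((V × Bool) ⊕ G.Dart) where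
  Adj a b := match a, b with
    | .inl _, .inl _ => False
    | .inl p, .inr d => d.fst = p.1
    | .inr d, .inl p => d.fst = p.1
    | .inr d, .inr e => e = d.symm
  symm := ⟨by
    rintro (a | a) (b | b) h
    · exact h
    · exact h
    · exact h
    · simp only at h ⊢
      rw [h, Dart.symm_symm]⟩
  loopless := ⟨by
    rintro (a | a) h
    · exact h
    · exact a.symm_ne h.symm⟩

theorem twoFactorGadget_adj_inl_inr (G : SimpleGraph V) (p : V × Bool) (d : G.Dart) :
    G.twoFactorGadget.Adj (.inl p) (.inr d) ↔ d.fst = p.1 := Iff.rfl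

theorem twoFactorGadget_adj_inr_inl (G : SimpleGraph V) (p : V × Bool) (d : G.Dart) :
    G.twoFactorGadget.Adj (.inr d) (.inl p) ↔ d.fst = p.1 := Iff.rfl

theorem twoFactorGadget_adj_inr_inr (G : SimpleGraph V) (d e : G.Dart) :
    G.twoFactorGadget.Adj (.inr d) (.inr e) ↔ e = d.symm := Iff.rfl

theorem twoFactorGadget_not_adj_inl_inl (G : SimpleGraph V) (p q : V × Bool) :
    ¬ G.twoFactorGadget.Adj (.inl p) (.inl q) := id

/-- The edges of `G` whose two darts are not matched to each other form a 2-factor. -/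
theorem exists_isTwoFactor_of_isPerfectMatching (G : SimpleGraph V)
    {M : G.twoFactorGadget.Subgraph} (hM : M.IsPerfectMatching) :
    ∃ H : G.Subgraph, IsTwoFactor H := by
  rw [Subgraph.isPerfectMatching_iff] at hM
  let H : G.Subgraph :=
    { verts := Set.univ
      Adj := fun u v => ∃ h : G.Adj u v, ¬ M.Adj (.inr ⟨(u, v), h⟩) (.inr ⟨(v, u), h.symm⟩)
      adj_sub := fun h => h.1
      edge_vert := fun _ => trivial
      symm := ⟨fun u v ⟨h, hn⟩ => ⟨h.symm, fun hc => hn hc.symm⟩⟩ }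
  have key : ∀ (v : V) (b : Bool), ∃ u, ∃ h : G.Adj v u, M.Adj (.inl (v, b)) (.inr ⟨(v, u), h⟩) := by
    intro v b
    obtain ⟨w, hw, -⟩ := hM (.inl (v, b))
    rcases w with p | ⟨⟨a, u⟩, h⟩
    · exact absurd hw.adj_sub (G.twoFactorGadget_not_adj_inl_inl _ _)
    · obtain rfl : a = v := (G.twoFactorGadget_adj_inl_inr _ _).1 hw.adj_sub
      exact ⟨u, h, hw⟩
  refine ⟨H, fun v => trivial, fun v => ?_⟩
  obtain ⟨a, ha, hMa⟩ := key v false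
  obtain ⟨b, hb, hMb⟩ := key v true
  refine Set.encard_eq_two.2 ⟨a, b, ?_, ?_⟩
  · rintro rfl
    simpa using (hM _).unique hMa.symm hMb.symm
  · ext u
    simp only [Subgraph.mem_neighborSet, Set.mem_insert_iff, Set.mem_singleton_iff]
    constructor
    · rintro ⟨h, hn⟩
      obtain ⟨w, hw, -⟩ := hM (.inr ⟨(v, u), h⟩)
      rcases w with ⟨x, c⟩ | e
      · obtain rfl : v = x := (G.twoFactorGadget_adj_inr_inl _ _).1 hw.adj_sub
        cases c
        · left; simpa using (hM _).unique hw.symm hMa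
        · right; simpa using (hM _).unique hw.symm hMb
      · obtain rfl := (G.twoFactorGadget_adj_inr_inr _ _).1 hw.adj_sub
        exact absurd hw hn
    · rintro (rfl | rfl)
      · exact ⟨ha, fun hc => by simpa using (hM _).unique hc hMa.symm⟩
      · exact ⟨hb, fun hc => by simpa using (hM _).unique hc hMb.symm⟩

/-! ### Minimal Tutte barriers -/

/-- `𝒦` is a family of pairwise disjoint sets of odd size, each of which avoids `A` and is a union
of connected components of the graph obtained by deleting `A`. -/
structure IsOddFamily (G : SimpleGraph V) (A : Finset V) (𝒦 : Finset (Finset V)) : Prop where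
  odd : ∀ K ∈ 𝒦, Odd K.card
  notMem : ∀ K ∈ 𝒦, ∀ v ∈ K, v ∉ A
  disj : ∀ K ∈ 𝒦, ∀ L ∈ 𝒦, ∀ v, v ∈ K → v ∈ L → K = L
  closed : ∀ K ∈ 𝒦, ∀ v ∈ K, ∀ w, w ∉ A → G.Adj v w → w ∈ K

/-- Tutte's theorem, with the odd components recorded as plain finsets. Connectedness is dropped so
that a family can later absorb a leftover union of components. -/
theorem exists_isOddFamily [Fintype V] [DecidableEq V] (G : SimpleGraph V)
    (h : ¬ ∃ M : G.Subgraph, M.IsPerfectMatching) :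
    ∃ A 𝒦, G.IsOddFamily A 𝒦 ∧ A.card < 𝒦.card := by
  classical
  rw [tutte] at h
  push Not at h
  obtain ⟨u, hu⟩ := h
  set G' := ((⊤ : G.Subgraph).deleteVerts u).coe with hG'
  let f : G'.ConnectedComponent → Finset V := fun c => (Subtype.val '' c.supp).toFinset
  have hf : ∀ c v, v ∈ f c ↔ ∃ x : ((⊤ : G.Subgraph).deleteVerts u).verts,
      G'.connectedComponentMk x = c ∧ x.1 = v := by
    intro c v
    simp [f]
  have hinj : ∀ c c' v, v ∈ f c → v ∈ f c' → c = c' := by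
    intro c c' v h h'
    obtain ⟨x, hx, rfl⟩ := (hf _ _).1 h
    obtain ⟨y, hy, hxy⟩ := (hf _ _).1 h'
    rw [← hx, ← hy, Subtype.ext hxy]
  have hne : ∀ c, (f c).Nonempty := by
    intro c
    obtain ⟨x, hx⟩ := c.nonempty_supp
    exact ⟨x, (hf _ _).2 ⟨x, hx, rfl⟩⟩
  have hodd : ∀ K, K ∈ G'.oddComponents.toFinset.image f ↔ ∃ c, Odd c.supp.ncard ∧ f c = K := by
    intro K; simp
  refine ⟨u.toFinset, G'.oddComponents.toFinset.image f, ⟨?_, ?_, ?_, ?_⟩, ?_⟩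
  · intro K hK
    obtain ⟨c, hc, rfl⟩ := (hodd K).1 hK
    rw [← Set.ncard_eq_toFinset_card', Set.ncard_image_of_injective _ Subtype.val_injective]
    exact hc
  · intro K hK v hv
    obtain ⟨c, hc, rfl⟩ := (hodd K).1 hK
    obtain ⟨x, hx, rfl⟩ := (hf _ _).1 hv
    simpa using x.2.2
  · intro K hK L hL v hv hv'
    obtain ⟨c, hc, rfl⟩ := (hodd K).1 hK
    obtain ⟨c', hc', rfl⟩ := (hodd L).1 hL
    rw [hinj _ _ _ hv hv']
  · intro K hK v hv w hw hvw
    obtain ⟨c, hc, rfl⟩ := (hodd K).1 hK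
    obtain ⟨x, hx, rfl⟩ := (hf _ _).1 hv
    have hw' : w ∉ u := by simpa using hw
    refine (hf _ _).2 ⟨⟨w, by simpa using hw'⟩, ?_, rfl⟩
    rw [← hx, ConnectedComponent.eq]
    refine Adj.reachable ?_
    have := x.2.2
    simp [hG', hvw.symm, hw', this]
  · rw [Finset.card_image_of_injective, ← Set.ncard_eq_toFinset_card', ← Set.ncard_eq_toFinset_card']
    · exact hu
    · intro c c' hcc
      obtain ⟨v, hv⟩ := hne c
      exact hinj _ _ v hv (hcc ▸ hv)

/-- In a graph of even order, a family with more than `#A` members can be enlarged to one with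
at least `#A + 2` members. -/
theorem IsOddFamily.exists_card_add_two_le [Fintype V] [DecidableEq V] {G : SimpleGraph V}
    (hV : Even (Fintype.card V)) {A 𝒦} (h : G.IsOddFamily A 𝒦) (hlt : A.card < 𝒦.card) :
    ∃ 𝒦', G.IsOddFamily A 𝒦' ∧ A.card + 2 ≤ 𝒦'.card := by
  by_cases h2 : A.card + 2 ≤ 𝒦.card
  · exact ⟨𝒦, h, h2⟩
  have hcard : 𝒦.card = A.card + 1 := by omega
  set B := 𝒦.biUnion id with hB
  have hmemB : ∀ v, v ∈ B ↔ ∃ K ∈ 𝒦, v ∈ K := by simp [hB]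
  have hBcard : B.card = ∑ K ∈ 𝒦, K.card :=
    Finset.card_biUnion fun K hK L hL hKL =>
      Finset.disjoint_left.2 fun v hv hv' => hKL (h.disj K hK L hL v hv hv')
  have hpar : B.card % 2 = 𝒦.card % 2 := by
    rw [hBcard, Finset.sum_nat_mod, Finset.sum_congr rfl fun K hK => Nat.odd_iff.1 (h.odd K hK)]
    simp
  have hAB : Disjoint A B := Finset.disjoint_left.2 fun v hv hv' => by
    obtain ⟨K, hK, hvK⟩ := (hmemB v).1 hv'
    exact h.notMem K hK v hvK hv
  -- Here |A| + |B| has the parity of 2|A| + 1, so the leftover L is odd; it is again a union of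
  -- components.
  set L := (A ∪ B)ᶜ with hL
  have hLcard : L.card + (A.card + B.card) = Fintype.card V := by
    rw [hL, ← Finset.card_union_of_disjoint hAB, Finset.card_compl_add_card]
  have hLodd : Odd L.card := by
    obtain ⟨k, hk⟩ := hV
    rw [Nat.odd_iff]
    omega
  have hmemL : ∀ v, v ∈ L ↔ v ∉ A ∧ ∀ K ∈ 𝒦, v ∉ K := by
    intro v
    simp [hL, hmemB]
  have hLnot : L ∉ 𝒦 := fun hL' => by
    obtain ⟨v, hv⟩ : L.Nonempty := Finset.card_pos.1 hLodd.pos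
    exact ((hmemL v).1 hv).2 L hL' hv
  refine ⟨insert L 𝒦, ⟨?_, ?_, ?_, ?_⟩, ?_⟩
  · intro K hK
    rcases Finset.mem_insert.1 hK with rfl | hK
    exacts [hLodd, h.odd K hK]
  · intro K hK v hv
    rcases Finset.mem_insert.1 hK with rfl | hK
    exacts [((hmemL v).1 hv).1, h.notMem K hK v hv]
  · intro K hK K' hK' v hv hv'
    rcases Finset.mem_insert.1 hK with rfl | hK <;> rcases Finset.mem_insert.1 hK' with rfl | hK'
    · rfl
    · exact absurd hv' (((hmemL v).1 hv).2 _ hK')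
    · exact absurd hv (((hmemL v).1 hv').2 _ hK)
    · exact h.disj K hK K' hK' v hv hv'
  · intro K hK v hv w hw hvw
    rcases Finset.mem_insert.1 hK with rfl | hK
    · rw [hmemL] at hv ⊢
      exact ⟨hw, fun K' hK' hwK => hv.2 K' hK' (h.closed K' hK' w hwK v hv.1 hvw.symm)⟩
    · exact h.closed K hK v hv w hw hvw
  · rw [Finset.card_insert_of_notMem hLnot]
    omega

open Classical in
/-- A graph of even order without a perfect matching has a barrier each of whose vertices is
adjacent to at least three members of the corresponding odd family. -/
theorem exists_isOddFamily_three_le [Fintype V] (G : SimpleGraph V) (hV : Even (Fintype.card V))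
    (h : ¬ ∃ M : G.Subgraph, M.IsPerfectMatching) :
    ∃ A 𝒦, G.IsOddFamily A 𝒦 ∧ A.card < 𝒦.card ∧
      ∀ a ∈ A, 3 ≤ (𝒦.filter fun K => ∃ v ∈ K, G.Adj a v).card := by
  have hex : ∃ n, ∃ A 𝒦, G.IsOddFamily A 𝒦 ∧ A.card < 𝒦.card ∧ A.card = n := by
    obtain ⟨A, 𝒦, h1, h2⟩ := G.exists_isOddFamily h
    exact ⟨_, A, 𝒦, h1, h2, rfl⟩
  obtain ⟨A, 𝒦₀, h₀, hlt₀, hn⟩ := Nat.find_spec hex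
  obtain ⟨𝒦, hK, h2⟩ := h₀.exists_card_add_two_le hV hlt₀
  refine ⟨A, 𝒦, hK, by omega, fun a ha => ?_⟩
  -- For |A| minimal: dropping `a` and the at most two members it meets leaves at least |A| members
  -- against |A| - 1 barrier vertices.
  by_contra! hlt
  have hpos : 0 < A.card := Finset.card_pos.2 ⟨a, ha⟩
  have hsplit := Finset.card_filter_add_card_filter_not (s := 𝒦) (fun K => ∃ v ∈ K, G.Adj a v)
  have hA' : (A.erase a).card = A.card - 1 := Finset.card_erase_of_mem ha
  refine Nat.find_min hex (m := (A.erase a).card) (by omega)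
    ⟨A.erase a, 𝒦.filter fun K => ¬ ∃ v ∈ K, G.Adj a v, ⟨?_, ?_, ?_, ?_⟩, by omega, rfl⟩
  · exact fun K hK' => hK.odd K (Finset.mem_filter.1 hK').1
  · exact fun K hK' v hv hva =>
      hK.notMem K (Finset.mem_filter.1 hK').1 v hv (Finset.mem_of_mem_erase hva)
  · exact fun K hK' L hL' =>
      hK.disj K (Finset.mem_filter.1 hK').1 L (Finset.mem_filter.1 hL').1
  · intro K hK' v hv w hw hvw
    obtain ⟨hK1, hK2⟩ := Finset.mem_filter.1 hK'
    by_cases hwa : w = a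
    · exact absurd ⟨v, hv, hwa ▸ hvw.symm⟩ hK2
    · exact hK.closed K hK1 v hv w (fun hwA => hw (Finset.mem_erase.2 ⟨hwa, hwA⟩)) hvw

/-- The members are disjoint, so no index is counted twice. -/
theorem IsOddFamily.sum_card_filter_mem_le [DecidableEq V] {G : SimpleGraph V} {A 𝒦}
    (h : G.IsOddFamily A 𝒦) {ι : Type*} (B : Finset ι) (f : ι → V) :
    ∑ K ∈ 𝒦, (B.filter fun b => f b ∈ K).card ≤ B.card := by
  classical
  rw [← Finset.card_biUnion]
  · exact Finset.card_le_card fun b hb => by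
      obtain ⟨K, -, hb⟩ := Finset.mem_biUnion.1 hb
      exact (Finset.mem_filter.1 hb).1
  · intro K hK L hL hne
    refine Finset.disjoint_left.2 fun b hb hb' => hne ?_
    exact h.disj K hK L hL (f b) (Finset.mem_filter.1 hb).2 (Finset.mem_filter.1 hb').2

open Classical in
/-- If `a` meets at least as many members of the family as it has neighbors, then its neighbors lie
in distinct members. -/
theorem IsOddFamily.exists_mem_of_card_le {G : SimpleGraph V}
    {A 𝒦} (h : G.IsOddFamily A 𝒦) {a : V} {N : Finset V} (hN : ∀ v, G.Adj a v → v ∈ N)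
    (hcard : N.card ≤ (𝒦.filter fun K => ∃ v ∈ K, G.Adj a v).card) {n : V} (hn : n ∈ N) :
    ∃ K ∈ 𝒦, n ∈ K ∧ ∀ m ∈ N, m ∈ K → m = n := by
  have hch : ∀ K : Finset V, ∃ v, (∃ v ∈ K, G.Adj a v) → v ∈ K ∧ G.Adj a v := by
    intro K
    by_cases hK : ∃ v ∈ K, G.Adj a v
    · exact ⟨hK.choose, fun _ => hK.choose_spec⟩
    · exact ⟨a, fun h => absurd h hK⟩
  choose g hg using hch
  set F := 𝒦.filter fun K => ∃ v ∈ K, G.Adj a v with hF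
  have hFm : ∀ K ∈ F, K ∈ 𝒦 ∧ g K ∈ K ∧ g K ∈ N := fun K hK => by
    obtain ⟨h1, h2⟩ := Finset.mem_filter.1 hK
    exact ⟨h1, (hg K h2).1, hN _ (hg K h2).2⟩
  have hinj : Set.InjOn g F := fun K hK L hL hKL =>
    h.disj K (hFm K hK).1 L (hFm L hL).1 (g K) (hFm K hK).2.1 (hKL ▸ (hFm L hL).2.1)
  -- One chosen neighbor per member met is an injection into N, onto by cardinality.
  have himg : F.image g = N := by
    refine Finset.eq_of_subset_of_card_le ?_ ?_
    · exact Finset.image_subset_iff.2 fun K hK => (hFm K hK).2.2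
    · rwa [Finset.card_image_of_injOn hinj]
  obtain ⟨K, hK, rfl⟩ := Finset.mem_image.1 (himg ▸ hn)
  refine ⟨K, (hFm K hK).1, (hFm K hK).2.1, fun m hm hmK => ?_⟩
  obtain ⟨L, hL, rfl⟩ := Finset.mem_image.1 (himg ▸ hm)
  rw [h.disj K (hFm K hK).1 L (hFm L hL).1 (g L) hmK (hFm L hL).2.1]

/-! ### Shape of the gadget barrier -/

open Classical in
/-- If `G` has no 2-factor, then its gadget graph has a barrier consisting of both copies of all
vertices in `S` and all darts leaving an independent set `T` disjoint from `S`. -/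
theorem exists_gadget_barrier [Fintype V] (G : SimpleGraph V)
    (h : ¬ ∃ H : G.Subgraph, IsTwoFactor H) :
    ∃ (S T : Finset V) (A : Finset ((V × Bool) ⊕ G.Dart)) (𝒦 : Finset (Finset _)),
      G.twoFactorGadget.IsOddFamily A 𝒦 ∧ A.card < 𝒦.card ∧
      (∀ v b, .inl (v, b) ∈ A ↔ v ∈ S) ∧ (∀ d, .inr d ∈ A ↔ d.fst ∈ T) ∧
      Disjoint S T ∧ (∀ u ∈ T, ∀ v ∈ T, ¬ G.Adj u v) ∧
      ∀ d : G.Dart, d.snd ∈ T → ∃ K ∈ 𝒦, .inr d ∈ K := by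
  have heven : Even (Fintype.card ((V × Bool) ⊕ G.Dart)) := by
    simp only [Fintype.card_sum, Fintype.card_prod, Fintype.card_bool,
      G.dart_card_eq_twice_card_edges]
    exact (even_two.mul_left _).add (even_two.mul_right _)
  obtain ⟨A, 𝒦, hK, hlt, h3⟩ := G.twoFactorGadget.exists_isOddFamily_three_le heven
    fun ⟨M, hM⟩ => h (G.exists_isTwoFactor_of_isPerfectMatching hM)
  obtain ⟨N, hN, hNcard⟩ : ∃ N : G.Dart → Finset ((V × Bool) ⊕ G.Dart),
      (∀ d x, x ∈ N d ↔ x = .inl (d.fst, false) ∨ x = .inl (d.fst, true) ∨ x = .inr d.symm) ∧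
      ∀ d, (N d).card ≤ 3 :=
    ⟨fun d => {.inl (d.fst, false), .inl (d.fst, true), .inr d.symm}, fun d x => by simp,
      fun d => Finset.card_le_three⟩
  -- A dart has only three neighbors but meets three members, so its neighbors lie in distinct
  -- members.
  have hdart : ∀ d : G.Dart, .inr d ∈ A → ∀ n ∈ N d, ∃ K ∈ 𝒦, n ∈ K ∧
      ∀ m ∈ N d, m ∈ K → m = n := by
    intro d hd n hn
    have hle := (hNcard d).trans (h3 (.inr d) hd)
    refine hK.exists_mem_of_card_le (a := .inr d) ?_ hle hn
    rintro (⟨v, b⟩ | e) hv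
    · rw [twoFactorGadget_adj_inr_inl] at hv
      cases b <;> simp [hv, hN]
    · rw [twoFactorGadget_adj_inr_inr] at hv
      simp [hv, hN]
  have hcore : ∀ (d : G.Dart) (b : Bool), .inr d ∈ A → .inl (d.fst, b) ∉ A := by
    intro d b hd
    obtain ⟨K, hK', hn, -⟩ := hdart d hd (.inl (d.fst, b)) (by cases b <;> simp [hN])
    exact hK.notMem K hK' _ hn
  have hsymm : ∀ d : G.Dart, .inr d ∈ A → ∃ K ∈ 𝒦, .inr d.symm ∈ K := by
    intro d hd
    obtain ⟨K, hK', hn, -⟩ := hdart d hd (.inr d.symm) (by simp [hN])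
    exact ⟨K, hK', hn⟩
  -- A dart `e` outside A would join the two copies of its start, which lie in distinct members.
  have hstar : ∀ d e : G.Dart, .inr d ∈ A → e.fst = d.fst → .inr e ∈ A := by
    intro d e hd he
    by_contra heA
    obtain ⟨K, hK', hn, hu⟩ := hdart d hd (.inl (d.fst, false)) (by simp [hN])
    have h1 : .inr e ∈ K := hK.closed K hK' _ hn _ heA
      ((G.twoFactorGadget_adj_inl_inr _ _).2 he)
    have h2 : .inl (d.fst, true) ∈ K := hK.closed K hK' _ h1 _ (hcore d _ hd)
      ((G.twoFactorGadget_adj_inr_inl _ _).2 he)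
    simpa using hu _ (by simp [hN]) h2
  -- Twin copies have the same neighbors, so every member met by the copy in A would contain its
  -- twin outside A; there would be only one such member.
  have htwin : ∀ v b c, .inl (v, b) ∈ A → .inl (v, c) ∈ A := by
    intro v b c hv
    by_contra hc
    have h2 := (Nat.lt_succ_self 2).trans_le (h3 (.inl (v, b)) hv)
    obtain ⟨K, hK1, L, hL1, hne⟩ := Finset.one_lt_card.1 ((Nat.lt_succ_self 1).trans h2)
    have key : ∀ K ∈ 𝒦.filter fun K => ∃ w ∈ K, G.twoFactorGadget.Adj (.inl (v, b)) w,
        K ∈ 𝒦 ∧ .inl (v, c) ∈ K := by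
      intro K hKF
      obtain ⟨hK', w, hw, hvw⟩ := Finset.mem_filter.1 hKF
      refine ⟨hK', ?_⟩
      rcases w with p | d
      · exact absurd hvw (G.twoFactorGadget_not_adj_inl_inl _ _)
      · rw [twoFactorGadget_adj_inl_inr] at hvw
        exact hK.closed K hK' _ hw _ hc ((G.twoFactorGadget_adj_inr_inl _ _).2 hvw)
    exact hne (hK.disj K (key K hK1).1 L (key L hL1).1 _ (key K hK1).2 (key L hL1).2)
  obtain ⟨S, hS⟩ : ∃ S : Finset V, ∀ v, v ∈ S ↔ .inl (v, false) ∈ A :=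
    ⟨Finset.univ.filter _, fun v => Finset.mem_filter_univ v⟩
  obtain ⟨T, hT'⟩ : ∃ T : Finset V, ∀ v, v ∈ T ↔ ∃ d : G.Dart, d.fst = v ∧ .inr d ∈ A :=
    ⟨Finset.univ.filter _, fun v => Finset.mem_filter_univ v⟩
  have hT : ∀ d : G.Dart, .inr d ∈ A ↔ d.fst ∈ T := fun d =>
    ⟨fun hd => (hT' _).2 ⟨d, rfl, hd⟩, fun hd => by
      obtain ⟨e, he, heA⟩ := (hT' _).1 hd
      exact hstar e d heA he.symm⟩
  refine ⟨S, T, A, 𝒦, hK, hlt, ?_, hT, ?_, ?_, ?_⟩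
  · exact fun v b => ⟨fun h => (hS v).2 (htwin v b false h), fun h => htwin v false b ((hS v).1 h)⟩
  · rw [Finset.disjoint_left]
    intro v hv hv'
    obtain ⟨d, rfl, hd⟩ := (hT' _).1 hv'
    exact hcore d _ hd ((hS _).1 hv)
  · intro u hu v hv huv
    have h1 := (hT ⟨(u, v), huv⟩).2 hu
    have h2 := (hT ⟨(v, u), huv.symm⟩).2 hv
    obtain ⟨K, hK', hd⟩ := hsymm _ h1
    exact hK.notMem K hK' _ hd h2
  · intro d hd
    simpa using hsymm d.symm ((hT d.symm).2 hd)

theorem even_card_of_involution {α : Type*} (K : Finset α) (σ : α → α)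
    (hmem : ∀ x ∈ K, σ x ∈ K) (hne : ∀ x ∈ K, σ x ≠ x) (hinv : ∀ x ∈ K, σ (σ x) = x) :
    Even K.card := by
  have h : ∑ _x ∈ K, (1 : ZMod 2) = 0 :=
    Finset.sum_involution (fun x _ => σ x) (fun _ _ => by decide) (fun x hx _ => hne x hx)
      hmem hinv
  rw [Finset.sum_const, nsmul_one] at h
  exact (ZMod.natCast_eq_zero_iff_even).1 h

open Classical in
/-- A member of the family containing no isolated vertex of the deleted gadget graph contains an
odd number of darts ending in `T`. -/
theorem odd_card_darts [Fintype V] {G : SimpleGraph V} (hdeg : ∀ v, ∃ u, G.Adj v u)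
    {S T : Finset V} {A : Finset ((V × Bool) ⊕ G.Dart)} {𝒦 : Finset (Finset _)}
    (hK : G.twoFactorGadget.IsOddFamily A 𝒦)
    (hS : ∀ v b, .inl (v, b) ∈ A ↔ v ∈ S) (hT : ∀ d, .inr d ∈ A ↔ d.fst ∈ T)
    {K : Finset _} (hK' : K ∈ 𝒦) (hcore : ∀ v b, .inl (v, b) ∈ K → v ∉ T)
    (hdart : ∀ d, .inr d ∈ K → d.snd ∈ T → d.fst ∉ S) :
    Odd ((Finset.univ.filter fun d : G.Dart => d.fst ∉ S ∧ d.fst ∉ T ∧ d.snd ∈ T).filter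
      fun d => .inr d ∈ K).card := by
  set E := (Finset.univ.filter fun d : G.Dart => d.fst ∉ S ∧ d.fst ∉ T ∧ d.snd ∈ T).filter
      fun d => .inr d ∈ K with hE
  have hmemE : ∀ d, d ∈ E ↔ .inr d ∈ K ∧ d.snd ∈ T := by
    intro d
    simp only [hE, Finset.mem_filter, Finset.mem_univ, true_and]
    refine ⟨fun h => ⟨h.2, h.1.2.2⟩, fun h => ⟨⟨hdart d h.1 h.2, ?_, h.2⟩, h.1⟩⟩
    exact fun hd => hK.notMem K hK' _ h.1 ((hT d).2 hd)
  -- Swap twin copies and reverse darts. Among the elements of K, only darts ending in T have their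
  -- partner in A, so σ preserves the rest.
  let σ : (V × Bool) ⊕ G.Dart → (V × Bool) ⊕ G.Dart :=
    Sum.map (fun p => (p.1, !p.2)) Dart.symm
  have hsub : E.map .inr ⊆ K := by
    intro x hx
    obtain ⟨d, hd, rfl⟩ := Finset.mem_map.1 hx
    exact ((hmemE d).1 hd).1
  have heven : Even (K \ E.map .inr).card := by
    refine even_card_of_involution _ σ ?_ ?_ ?_
    · rintro (⟨v, b⟩ | d) hx
      · have hv := (Finset.mem_sdiff.1 hx).1
        obtain ⟨u, hu⟩ := hdeg v
        have h1 : .inr ⟨(v, u), hu⟩ ∈ K := hK.closed K hK' _ hv _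
          (fun h => hcore v b hv ((hT _).1 h)) ((G.twoFactorGadget_adj_inl_inr _ _).2 rfl)
        have h2 : .inl (v, !b) ∈ K := hK.closed K hK' _ h1 _
          (fun h => hK.notMem K hK' _ hv ((hS v b).2 ((hS v _).1 h)))
          ((G.twoFactorGadget_adj_inr_inl _ _).2 rfl)
        simp [σ, h2]
      · obtain ⟨hd, hdE⟩ := Finset.mem_sdiff.1 hx
        have hdT : d.snd ∉ T := fun h =>
          hdE (Finset.mem_map.2 ⟨d, (hmemE d).2 ⟨hd, h⟩, rfl⟩)
        have h1 : .inr d.symm ∈ K := hK.closed K hK' _ hd _ (fun h => hdT ((hT _).1 h))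
          ((G.twoFactorGadget_adj_inr_inr _ _).2 rfl)
        have h2 : d.fst ∉ T := fun h => hK.notMem K hK' _ hd ((hT d).2 h)
        simp [σ, h1, hmemE, h2]
    · rintro (⟨v, b⟩ | d) -
      · simp [σ]
      · simpa [σ] using d.symm_ne
    · rintro (⟨v, b⟩ | d) - <;> simp [σ]
  have hodd := hK.odd K hK'
  rw [← Finset.card_sdiff_add_card_eq_card hsub, Finset.card_map] at hodd
  rw [Nat.odd_add] at hodd
  exact (Nat.not_even_iff_odd.1 fun h => Nat.not_odd_iff_even.2 heven (hodd.2 h))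

/-! ### The barrier inequality -/

/-- `x` has no neighbor in `S` and shares no neighbor with any other vertex of `T`. -/
def IsPrivate (G : SimpleGraph V) (S T : Finset V) (x : V) : Prop :=
  (∀ s ∈ S, ¬ G.Adj x s) ∧ ∀ t ∈ T, t ≠ x → ∀ w, G.Adj x w → ¬ G.Adj t w

/-- Some path `x, w, w'` ends at a vertex outside `S ∪ T`. -/
def HasOuterPath (G : SimpleGraph V) (S T : Finset V) (x : V) : Prop :=
  ∃ w w', G.Adj x w ∧ G.Adj w w' ∧ w' ∉ S ∧ w' ∉ T

/-- `w` lies outside `S ∪ T` and has two neighbors in `T`. -/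
def IsShared (G : SimpleGraph V) (S T : Finset V) (w : V) : Prop :=
  w ∉ S ∧ w ∉ T ∧ ∃ t ∈ T, ∃ t' ∈ T, t ≠ t' ∧ G.Adj t w ∧ G.Adj t' w

open Classical in
/-- A graph without a 2-factor in which any two vertices with a common neighbor have another one
has a barrier `S, T` for which `T` is large. -/
theorem exists_barrier [Fintype V] (G : SimpleGraph V) (hdeg : ∀ v, ∃ u, G.Adj v u)
    (hcommon : ∀ u v w, u ≠ v → G.Adj u w → G.Adj v w → ∃ w', w' ≠ w ∧ G.Adj u w' ∧ G.Adj v w')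
    (h : ¬ ∃ H : G.Subgraph, IsTwoFactor H) :
    ∃ S T : Finset V, Disjoint S T ∧ (∀ u ∈ T, ∀ v ∈ T, ¬ G.Adj u v) ∧
      S.card + (Finset.univ.filter fun w => G.IsShared S T w).card +
        (T.filter fun x => G.IsPrivate S T x ∧ G.HasOuterPath S T x).card < T.card := by
  obtain ⟨S, T, A, 𝒦, hK, hlt, hS, hT, hST, hindep, hcov⟩ := G.exists_gadget_barrier h
  refine ⟨S, T, hST, hindep, ?_⟩
  set M := Finset.univ.filter fun w => G.IsShared S T w with hM
  set X := T.filter fun x => G.IsPrivate S T x ∧ G.HasOuterPath S T x with hX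
  have hmemM : ∀ w, w ∈ M ↔ G.IsShared S T w := fun w => Finset.mem_filter_univ w
  have hmemX : ∀ x, x ∈ X ↔ x ∈ T ∧ G.IsPrivate S T x ∧ G.HasOuterPath S T x :=
    fun x => Finset.mem_filter
  have hMX : Disjoint M X := Finset.disjoint_left.2 fun w hw hx =>
    ((hmemM w).1 hw).2.1 ((hmemX w).1 hx).1
  set E : Finset G.Dart := Finset.univ.filter fun d => d.fst ∉ S ∧ d.fst ∉ T ∧ d.snd ∈ T with hE
  set F : Finset G.Dart := Finset.univ.filter fun d => d.fst ∈ S ∧ d.snd ∈ T with hF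
  have hmemE : ∀ d, d ∈ E ↔ d.fst ∉ S ∧ d.fst ∉ T ∧ d.snd ∈ T := fun d => Finset.mem_filter_univ d
  have hmemF : ∀ d, d ∈ F ↔ d.fst ∈ S ∧ d.snd ∈ T := fun d => Finset.mem_filter_univ d
  -- the size of the barrier
  have hAcard : A.card = 2 * S.card + (F.card + E.card) := by
    have h1 : A.toLeft = S ×ˢ Finset.univ := by
      ext ⟨v, b⟩
      simp [hS]
    -- Darts leaving T are the reverses of those ending in T; by independence the latter start in S
    -- or outside S ∪ T.
    have h2 : A.toRight.card = (F ∪ E).card := by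
      refine Finset.card_bij (fun d _ => d.symm) ?_ ?_ ?_
      · intro d hd
        have hd' : d.fst ∈ T := (hT d).1 (Finset.mem_toRight.1 hd)
        have : d.snd ∉ T := fun h => hindep _ hd' _ h d.adj
        rw [Finset.mem_union, hmemE, hmemF]
        change (d.snd ∈ S ∧ d.fst ∈ T) ∨ (d.snd ∉ S ∧ d.snd ∉ T ∧ d.fst ∈ T)
        tauto
      · intro d _ e _ hde
        exact Dart.symm_involutive.injective hde
      · intro d hd
        refine ⟨d.symm, ?_, d.symm_symm⟩
        rw [Finset.mem_toRight, hT]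
        rw [Finset.mem_union, hmemE, hmemF] at hd
        change d.snd ∈ T
        tauto
    have h3 : Disjoint F E := Finset.disjoint_left.2 fun d hd hd' =>
      ((hmemE d).1 hd').1 ((hmemF d).1 hd).1
    rw [← Finset.card_toLeft_add_card_toRight, h1, h2, Finset.card_union_of_disjoint h3,
      Finset.card_product, Finset.card_univ, Fintype.card_bool, mul_comm]
  -- These are isolated once A is deleted: copies of T, and darts from S to T.
  set I : Finset ((V × Bool) ⊕ G.Dart) := (T ×ˢ Finset.univ).disjSum F with hI
  have hIcard : I.card = 2 * T.card + F.card := by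
    rw [hI, Finset.card_disjSum, Finset.card_product, Finset.card_univ, Fintype.card_bool, mul_comm]
  -- each dart from outside `S ∪ T` to `T` is charged to a vertex
  let φ : G.Dart → V := fun d => if d.fst ∈ M then d.fst else d.snd
  let EK : Finset ((V × Bool) ⊕ G.Dart) → Finset G.Dart := fun K => E.filter fun d => .inr d ∈ K
  let YK : Finset ((V × Bool) ⊕ G.Dart) → Finset V := fun K =>
    (M ∪ X).filter fun y => 2 ≤ ((EK K).filter fun d => φ d = y).card
  have hYE : ∀ K, 2 * (YK K).card ≤ (EK K).card := by
    intro K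
    calc 2 * (YK K).card = ∑ _y ∈ YK K, 2 := by rw [Finset.sum_const, smul_eq_mul, mul_comm]
      _ ≤ ∑ y ∈ YK K, ((EK K).filter fun d => φ d = y).card :=
        Finset.sum_le_sum fun y hy => (Finset.mem_filter.1 hy).2
      _ = ((EK K).filter fun d => φ d ∈ YK K).card :=
        Finset.sum_card_fiberwise_eq_card_filter _ _ _
      _ ≤ (EK K).card := Finset.card_le_card (Finset.filter_subset _ _)
  have hstep : ∀ K ∈ 𝒦, ∀ u v w (huv : G.Adj u v) (huw : G.Adj u w), u ∉ S → u ∉ T →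
      .inr ⟨(u, v), huv⟩ ∈ K → .inr ⟨(u, w), huw⟩ ∈ K := by
    intro K hK' u v w huv huw huS huT hd
    have h1 : .inl (u, false) ∈ K := hK.closed K hK' _ hd _ (fun h => huS ((hS _ _).1 h))
      ((G.twoFactorGadget_adj_inr_inl _ _).2 rfl)
    exact hK.closed K hK' _ h1 _ (fun h => huT ((hT _).1 h))
      ((G.twoFactorGadget_adj_inl_inr _ _).2 rfl)
  have hrev : ∀ K ∈ 𝒦, ∀ u v (huv : G.Adj u v), v ∉ T →
      .inr ⟨(u, v), huv⟩ ∈ K → .inr ⟨(v, u), huv.symm⟩ ∈ K := by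
    intro K hK' u v huv hvT hd
    exact hK.closed K hK' _ hd _ (fun h => hvT ((hT _).1 h))
      ((G.twoFactorGadget_adj_inr_inr _ _).2 rfl)
  have hmemYK : ∀ K, ∀ y ∈ M ∪ X, ∀ d e, d ≠ e → d ∈ E → e ∈ E → .inr d ∈ K → .inr e ∈ K →
      φ d = y → φ e = y → y ∈ YK K := by
    intro K y hy d e hde hd he hdK heK hφd hφe
    refine Finset.mem_filter.2 ⟨hy, Finset.one_lt_card.2 ⟨d, ?_, e, ?_, hde⟩⟩
    · exact Finset.mem_filter.2 ⟨Finset.mem_filter.2 ⟨hd, hdK⟩, hφd⟩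
    · exact Finset.mem_filter.2 ⟨Finset.mem_filter.2 ⟨he, heK⟩, hφe⟩
  -- Every vertex of M ∪ X is charged twice within a single member.
  have hY : M ∪ X ⊆ 𝒦.biUnion YK := by
    intro y hy
    rw [Finset.mem_biUnion]
    rcases Finset.mem_union.1 hy with hyM | hyX
    · obtain ⟨hyS, hyT, t, ht, t', ht', hne, hty, hty'⟩ := (hmemM y).1 hyM
      obtain ⟨K, hK', hd⟩ := hcov ⟨(y, t), hty.symm⟩ ht
      refine ⟨K, hK', hmemYK K y hy ⟨(y, t), hty.symm⟩ ⟨(y, t'), hty'.symm⟩ ?_ ?_ ?_ hd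
        (hstep K hK' _ _ _ _ _ hyS hyT hd) (if_pos hyM) (if_pos hyM)⟩
      · intro h
        exact hne (congrArg (fun d : G.Dart => d.snd) h)
      · exact (hmemE _).2 ⟨hyS, hyT, ht⟩
      · exact (hmemE _).2 ⟨hyS, hyT, ht'⟩
    · obtain ⟨hyT, ⟨hpS, hpT⟩, w, w', hyw, hww', hwS', hwT'⟩ := (hmemX y).1 hyX
      have hout : ∀ v, G.Adj y v → v ∉ S ∧ v ∉ T ∧ v ∉ M := by
        intro v hv
        refine ⟨fun h => hpS v h hv, fun h => hindep y hyT v h hv, fun h => ?_⟩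
        obtain ⟨-, -, t, ht, t', ht', hne, htv, htv'⟩ := (hmemM v).1 h
        by_cases hty : t = y
        · exact hpT t' ht' (fun h => hne (hty.trans h.symm)) v hv htv'
        · exact hpT t ht hty v hv htv
      have hne : y ≠ w' := fun h => hwT' (h ▸ hyT)
      -- The 4-cycle y, w, w', w₂ links the darts (w, y) and (w₂, y) in the gadget without passing
      -- through A.
      obtain ⟨w₂, hw₂, hyw₂, hw'w₂⟩ := hcommon y w' w hne hyw hww'.symm
      obtain ⟨hwS, hwT, hwM⟩ := hout w hyw
      obtain ⟨hwS₂, hwT₂, hwM₂⟩ := hout w₂ hyw₂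
      obtain ⟨K, hK', hd⟩ := hcov ⟨(w, y), hyw.symm⟩ hyT
      have h1 := hstep K hK' _ _ _ _ hww' hwS hwT hd
      have h2 := hrev K hK' _ _ _ hwT' h1
      have h3 := hstep K hK' _ _ _ _ hw'w₂ hwS' hwT' h2
      have h4 := hrev K hK' _ _ _ hwT₂ h3
      have h5 := hstep K hK' _ _ _ _ hyw₂.symm hwS₂ hwT₂ h4
      refine ⟨K, hK', hmemYK K y hy ⟨(w, y), hyw.symm⟩ ⟨(w₂, y), hyw₂.symm⟩ ?_ ?_ ?_ hd h5
        (if_neg hwM) (if_neg hwM₂)⟩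
      · intro h
        exact hw₂ (congrArg (fun d : G.Dart => d.fst) h).symm
      · exact (hmemE _).2 ⟨hwS, hwT, hyT⟩
      · exact (hmemE _).2 ⟨hwS₂, hwT₂, hyT⟩
  have hper : ∀ K ∈ 𝒦, 1 + 2 * (YK K).card ≤ (I.filter fun i => i ∈ K).card + (EK K).card := by
    intro K hK'
    have hle := hYE K
    by_cases hIK : ∃ i ∈ I, i ∈ K
    · obtain ⟨i, hi, hiK⟩ := hIK
      have : 0 < (I.filter fun i => i ∈ K).card :=
        Finset.card_pos.2 ⟨i, Finset.mem_filter.2 ⟨hi, hiK⟩⟩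
      omega
    · push Not at hIK
      -- An odd number that is at least 2|YK K| is at least 2|YK K| + 1.
      have hodd : Odd (EK K).card := odd_card_darts hdeg hK hS hT hK'
        (fun v b hv hvT => hIK _ (by simp [hI, hvT]) hv)
        (fun d hd hdT hdS => hIK (.inr d) (by simp [hI, hmemF, hdT, hdS]) hd)
      obtain ⟨k, hk⟩ := hodd
      omega
  have hsum : 𝒦.card + 2 * (M ∪ X).card ≤ I.card + E.card := by
    have h1 : (M ∪ X).card ≤ ∑ K ∈ 𝒦, (YK K).card :=
      (Finset.card_le_card hY).trans Finset.card_biUnion_le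
    have h2 := Finset.sum_le_sum hper
    have h3 := hK.sum_card_filter_mem_le I id
    have h4 := hK.sum_card_filter_mem_le E Sum.inr
    rw [Finset.sum_add_distrib, Finset.sum_add_distrib, ← Finset.mul_sum, Finset.sum_const,
      smul_eq_mul, mul_one] at h2
    simp only [id] at h3
    simp only [EK] at h2
    omega
  rw [Finset.card_union_of_disjoint hMX] at hsum
  -- With |A| < |𝒦| the terms |F| and |E| cancel, leaving twice the claim.
  omega

open Classical in
/-- In a graph of minimum degree at least 2 satisfying the s-quadrangular inequality, an independent
set `T` is never as large as a barrier `S, T` would require. -/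
theorem card_le_of_commonNeighbors [Fintype V] (G : SimpleGraph V)
    (hdeg : ∀ v, ∃ a b, a ≠ b ∧ G.Adj v a ∧ G.Adj v b)
    (hquad : ∀ Q : Finset V, (∀ u ∈ Q, ∃ v ∈ Q, v ≠ u ∧ ∃ w, G.Adj u w ∧ G.Adj v w) →
      Q.card ≤ (Finset.univ.filter fun w =>
        ∃ u ∈ Q, ∃ v ∈ Q, u ≠ v ∧ G.Adj u w ∧ G.Adj v w).card)
    {S T : Finset V} (hindep : ∀ u ∈ T, ∀ v ∈ T, ¬ G.Adj u v) :
    T.card ≤ S.card + (Finset.univ.filter fun w => G.IsShared S T w).card +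
        (T.filter fun x => G.IsPrivate S T x ∧ G.HasOuterPath S T x).card := by
  set M := Finset.univ.filter fun w => G.IsShared S T w with hM
  set X := T.filter fun x => G.IsPrivate S T x ∧ G.HasOuterPath S T x with hX
  set Y := T.filter fun x => G.IsPrivate S T x ∧ ¬ G.HasOuterPath S T x with hY
  have hmemM : ∀ w, w ∈ M ↔ G.IsShared S T w := fun w => Finset.mem_filter_univ w
  have hmemX : ∀ x, x ∈ X ↔ x ∈ T ∧ G.IsPrivate S T x ∧ G.HasOuterPath S T x :=
    fun x => Finset.mem_filter
  have hmemY : ∀ x, x ∈ Y ↔ x ∈ T ∧ G.IsPrivate S T x ∧ ¬ G.HasOuterPath S T x :=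
    fun x => Finset.mem_filter
  set W := Finset.univ.filter fun w => ∃ x ∈ Y, G.Adj x w with hW
  have hmemW : ∀ w, w ∈ W ↔ ∃ x ∈ Y, G.Adj x w := fun w => Finset.mem_filter_univ w
  have hYpriv : ∀ x ∈ Y, ∀ w, G.Adj x w → ∀ t ∈ T, G.Adj t w → t = x := by
    intro x hx w hxw t ht htw
    by_contra hne
    exact ((hmemY x).1 hx).2.1.2 t ht hne w hxw htw
  have hWT : ∀ w ∈ W, w ∉ T := by
    intro w hw hwT
    obtain ⟨x, hx, hxw⟩ := (hmemW w).1 hw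
    exact hindep x ((hmemY x).1 hx).1 w hwT hxw
  have hWnbr : ∀ w ∈ W, ∀ v, G.Adj w v → v ∈ S ∨ v ∈ Y := by
    intro w hw v hwv
    obtain ⟨x, hx, hxw⟩ := (hmemW w).1 hw
    by_cases hvS : v ∈ S
    · exact Or.inl hvS
    by_cases hvT : v ∈ T
    · exact Or.inr (hYpriv x hx w hxw v hvT hwv.symm ▸ hx)
    · exact absurd ⟨w, v, hxw, hwv, hvS, hvT⟩ ((hmemY x).1 hx).2.2
  -- Vertices of Y have pairwise disjoint neighborhoods, each of size at least two.
  have hcardW : 2 * Y.card ≤ W.card := by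
    have hbool : ∀ v, ∃ f : Bool → V, (∀ c d, f c = f d → c = d) ∧ ∀ c, G.Adj v (f c) := by
      intro v
      obtain ⟨a, b, hab, ha, hb⟩ := hdeg v
      refine ⟨fun c => cond c a b, ?_, ?_⟩
      · rintro (_ | _) (_ | _) h
        exacts [rfl, absurd h.symm hab, absurd h hab, rfl]
      · rintro (_ | _)
        exacts [hb, ha]
    choose f hinj hadj using hbool
    have h : (Y ×ˢ (Finset.univ : Finset Bool)).card ≤ W.card := by
      refine Finset.card_le_card_of_injOn (fun p => f p.1 p.2) ?_ ?_
      · exact fun p hp => (hmemW _).2 ⟨p.1, (Finset.mem_product.1 hp).1, hadj _ _⟩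
      · rintro ⟨x, c⟩ hp ⟨y, d⟩ hq (hpq : f x c = f y d)
        have hx : x ∈ Y := (Finset.mem_product.1 hp).1
        have hy : y ∈ Y := (Finset.mem_product.1 hq).1
        obtain rfl : y = x := hYpriv x hx _ (hadj x c) y ((hmemY y).1 hy).1 (hpq ▸ hadj y d)
        rw [hinj _ _ _ hpq]
    rw [Finset.card_product, Finset.card_univ, Fintype.card_bool] at h
    omega
  set Z := T ∪ W with hZ
  have hZcard : Z.card = T.card + W.card :=
    Finset.card_union_of_disjoint (Finset.disjoint_right.2 hWT)
  set Q := Z.filter fun u => ∃ v ∈ Z, v ≠ u ∧ ∃ w, G.Adj u w ∧ G.Adj v w with hQ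
  set R := Z.filter fun u => ¬ ∃ v ∈ Z, v ≠ u ∧ ∃ w, G.Adj u w ∧ G.Adj v w with hR
  have hQR : Q.card + R.card = Z.card := Finset.card_filter_add_card_filter_not _
  have hmemQ : ∀ u, u ∈ Q ↔ u ∈ Z ∧ ∃ v ∈ Z, v ≠ u ∧ ∃ w, G.Adj u w ∧ G.Adj v w :=
    fun u => Finset.mem_filter
  have hmemR : ∀ u, u ∈ R ↔ u ∈ Z ∧ ¬ ∃ v ∈ Z, v ≠ u ∧ ∃ w, G.Adj u w ∧ G.Adj v w :=
    fun u => Finset.mem_filter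
  set C := Finset.univ.filter fun w => ∃ u ∈ Q, ∃ v ∈ Q, u ≠ v ∧ G.Adj u w ∧ G.Adj v w with hC
  have hmemC : ∀ w, w ∈ C ↔ ∃ u ∈ Q, ∃ v ∈ Q, u ≠ v ∧ G.Adj u w ∧ G.Adj v w :=
    fun w => Finset.mem_filter_univ w
  have hQC : Q.card ≤ C.card := by
    refine hquad Q fun u hu => ?_
    obtain ⟨huZ, v, hv, hne, w, huw, hvw⟩ := (hmemQ u).1 hu
    exact ⟨v, (hmemQ v).2 ⟨hv, u, huZ, hne.symm, w, hvw, huw⟩, hne, w, huw, hvw⟩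
  -- Neighbors of W lie in S ∪ Y, so a vertex of C outside S ∪ Y gets both its witnesses from T and
  -- is shared.
  have hCsub : C ⊆ (S ∩ C) ∪ (Y ∪ M) := by
    intro y hy
    obtain ⟨u, hu, v, hv, hne, huy, hvy⟩ := (hmemC y).1 hy
    by_cases hyS : y ∈ S
    · exact Finset.mem_union_left _ (Finset.mem_inter.2 ⟨hyS, hy⟩)
    refine Finset.mem_union_right _ (Finset.mem_union.2 ?_)
    by_cases hyY : y ∈ Y
    · exact Or.inl hyY
    have key : ∀ z ∈ Q, G.Adj z y → z ∈ T := by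
      intro z hz hzy
      rcases Finset.mem_union.1 ((hmemQ z).1 hz).1 with h | h
      · exact h
      · rcases hWnbr z h y hzy with h | h
        exacts [absurd h hyS, absurd h hyY]
    refine Or.inr ((hmemM y).2 ⟨hyS, fun h => ?_, u, key u hu huy, v, key v hv hvy, hne, huy, hvy⟩)
    exact hindep u (key u hu huy) y h huy
  -- A vertex of W shares its neighbor x in Y with another neighbor of x, so it lies in Q.
  have hRW : ∀ r ∈ R, r ∈ T := by
    intro r hr
    rcases Finset.mem_union.1 ((hmemR r).1 hr).1 with h | h
    · exact h
    obtain ⟨x, hx, hxr⟩ := (hmemW r).1 h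
    obtain ⟨a, b, hab, ha, hb⟩ := hdeg x
    have : ∃ v, v ≠ r ∧ G.Adj x v := by
      by_cases har : a = r
      · exact ⟨b, fun h => hab (har.trans h.symm), hb⟩
      · exact ⟨a, har, ha⟩
    obtain ⟨v, hvr, hxv⟩ := this
    exact absurd ⟨v, Finset.mem_union_right _ ((hmemW v).2 ⟨x, hx, hxv⟩), hvr, x, hxr.symm, hxv.symm⟩
      ((hmemR r).1 hr).2
  set R' := R.filter fun r => ¬ G.IsPrivate S T r with hR'
  have hRsub : R ⊆ R' ∪ (X ∪ Y) := by
    intro r hr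
    simp only [Finset.mem_union, hmemX, hmemY, hR', Finset.mem_filter]
    have := hRW r hr
    tauto
  -- Each r in R' has a neighbor in S with no other neighbor in Z; this neighbor avoids C and
  -- determines r.
  have hR'card : R'.card ≤ (S \ C).card := by
    have hex : ∀ r ∈ R', ∃ s ∈ S, G.Adj r s := by
      intro r hr
      obtain ⟨hrR, hrp⟩ := Finset.mem_filter.1 hr
      by_contra! hno
      refine hrp ⟨hno, fun t ht hne w hrw htw => ?_⟩
      exact ((hmemR r).1 hrR).2 ⟨t, Finset.mem_union_left _ ht, hne, w, hrw, htw⟩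
    have huniq : ∀ r ∈ R', ∀ z ∈ Z, ∀ s, G.Adj r s → G.Adj z s → z = r := by
      intro r hr z hz s hrs hzs
      by_contra hne
      exact ((hmemR r).1 (Finset.mem_filter.1 hr).1).2 ⟨z, hz, hne, s, hrs, hzs⟩
    choose! f hfS hf using hex
    refine Finset.card_le_card_of_injOn f (fun r hr => Finset.mem_sdiff.2 ⟨hfS r hr, fun h => ?_⟩) ?_
    · obtain ⟨u, hu, v, hv, hne, hus, hvs⟩ := (hmemC _).1 h
      exact hne ((huniq r hr u ((hmemQ u).1 hu).1 _ (hf r hr) hus).trans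
        (huniq r hr v ((hmemQ v).1 hv).1 _ (hf r hr) hvs).symm)
    · intro r hr r' hr' hrr
      have hr'Z := ((hmemR r').1 (Finset.mem_filter.1 hr').1).1
      exact (huniq r hr r' hr'Z (f r) (hf r hr) (hrr ▸ hf r' hr')).symm
  have h1 := (Finset.card_le_card hCsub).trans (Finset.card_union_le _ _)
  have h2 := Finset.card_union_le Y M
  have h3 := (Finset.card_le_card hRsub).trans (Finset.card_union_le _ _)
  have h4 := Finset.card_union_le X Y
  have h5 := Finset.card_inter_add_card_sdiff S C
  -- |T| + 2|Y| ≤ |Q| + |R| ≤ (|S ∩ C| + |Y| + |M|) + (|S \ C| + |X| + |Y|), and 2|Y| cancels.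
  omega

/-! ### Consequences of s-quadrangularity and conclusion -/

open Classical in
theorem IsSQuadrangular.card_le [Fintype V] {G : SimpleGraph V} (h : G.IsSQuadrangular)
    (Q : Finset V) (hQ : ∀ u ∈ Q, ∃ v ∈ Q, v ≠ u ∧ ∃ w, G.Adj u w ∧ G.Adj v w) :
    Q.card ≤ (Finset.univ.filter fun w =>
      ∃ u ∈ Q, ∃ v ∈ Q, u ≠ v ∧ G.Adj u w ∧ G.Adj v w).card := by
  rcases Q.eq_empty_or_nonempty with rfl | ⟨u, hu⟩
  · simp
  obtain ⟨v, hv, hne, -⟩ := hQ u hu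
  have h2 : 2 ≤ (Q : Set V).encard := by
    rw [Set.encard_coe_eq_coe_finsetCard]
    exact_mod_cast Finset.one_lt_card.2 ⟨u, hu, v, hv, hne.symm⟩
  have hle := h.1 Q ⟨h2, hQ⟩
  have hC : G.completeBiorientation.commonOut (Q : Set V) = (Finset.univ.filter fun w =>
      ∃ u ∈ Q, ∃ v ∈ Q, u ≠ v ∧ G.Adj u w ∧ G.Adj v w : Finset V) := by
    ext w
    simp [Digraph.commonOut, Digraph.outNbrs, completeBiorientation]
  rw [hC, Set.encard_coe_eq_coe_finsetCard, Set.encard_coe_eq_coe_finsetCard] at hle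
  exact_mod_cast hle

/-- The q-set {u, v} forces at least two common neighbors. -/
theorem IsSQuadrangular.exists_ne_common [Fintype V] {G : SimpleGraph V} (h : G.IsSQuadrangular)
    {u v w : V} (huv : u ≠ v) (huw : G.Adj u w) (hvw : G.Adj v w) :
    ∃ w', w' ≠ w ∧ G.Adj u w' ∧ G.Adj v w' := by
  classical
  have hle := h.card_le {u, v} (by
    intro x hx
    rcases Finset.mem_insert.1 hx with rfl | hx
    · exact ⟨v, by simp, huv.symm, w, huw, hvw⟩
    · obtain rfl := Finset.mem_singleton.1 hx
      exact ⟨u, by simp, huv, w, hvw, huw⟩)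
  rw [Finset.card_pair huv] at hle
  obtain ⟨w', hw', hne⟩ := Finset.exists_mem_ne hle w
  obtain ⟨-, x, hx, y, hy, hxy, hxw, hyw⟩ := Finset.mem_filter.1 hw'
  simp only [Finset.mem_insert, Finset.mem_singleton] at hx hy
  refine ⟨w', hne, ?_⟩
  rcases hx with rfl | rfl <;> rcases hy with rfl | rfl
  · exact absurd rfl hxy
  · exact ⟨hxw, hyw⟩
  · exact ⟨hyw, hxw⟩
  · exact absurd rfl hxy

/-- If a is the only neighbor of v, connectivity and a third vertex give a neighbor z ≠ v of a. Then
v and z share a, hence also a second vertex. -/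
theorem IsSQuadrangular.exists_two_adj [Fintype V] {G : SimpleGraph V} (h : G.IsSQuadrangular)
    (hconn : G.Connected) (hcard : 3 ≤ Fintype.card V) (v : V) :
    ∃ a b, a ≠ b ∧ G.Adj v a ∧ G.Adj v b := by
  classical
  have hstep : ∀ a, G.Adj v a → ∀ z, z ≠ v → G.Adj a z → ∃ a b, a ≠ b ∧ G.Adj v a ∧ G.Adj v b := by
    intro a hva z hz haz
    obtain ⟨b, hb, hvb, -⟩ := h.exists_ne_common hz.symm hva haz.symm
    exact ⟨a, b, hb.symm, hva, hvb⟩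
  by_contra hno
  have hnt : Nontrivial V := Fintype.one_lt_card_iff_nontrivial.1 (by omega)
  obtain ⟨a, hva⟩ := hconn.preconnected.exists_adj_of_nontrivial v
  have hclosed : ∀ x y, G.Adj x y → x ∈ ({v, a} : Finset V) → y ∈ ({v, a} : Finset V) := by
    intro x y hxy hx
    simp only [Finset.mem_insert, Finset.mem_singleton] at hx ⊢
    rcases hx with rfl | rfl
    · by_contra! hy
      exact hno ⟨a, y, hy.2.symm, hva, hxy⟩
    · by_contra! hy
      exact hno (hstep x hva y hy.1 hxy)
  have hall : ∀ y, y ∈ ({v, a} : Finset V) := by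
    intro y
    obtain ⟨p⟩ := hconn.preconnected v y
    have : ∀ {x y : V}, G.Walk x y → x ∈ ({v, a} : Finset V) → y ∈ ({v, a} : Finset V) := by
      intro x y p
      induction p with
      | nil => exact id
      | cons hxy _ ih => exact fun hx => ih (hclosed _ _ hxy hx)
    exact this p (by simp)
  have : Fintype.card V ≤ 2 := by
    rw [← Finset.card_univ, ← Finset.eq_univ_iff_forall.2 hall]
    exact Finset.card_le_two
  omega

end SimpleGraph

theorem theorem3p3 {V : Type*} [Finite V] (G : SimpleGraph V)
    (hconn : G.Connected) (hcard : 3 ≤ Nat.card V) (hquad : G.IsSQuadrangular) :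
    ∃ H : G.Subgraph, SimpleGraph.IsTwoFactor H := by
  classical
  cases nonempty_fintype V
  rw [Nat.card_eq_fintype_card] at hcard
  have hdeg := hquad.exists_two_adj hconn hcard
  by_contra h
  obtain ⟨S, T, -, hindep, hlt⟩ := G.exists_barrier
    (fun v => (hdeg v).imp fun a ⟨_, _, ha, _⟩ => ha)
    (fun u v w huv huw hvw => hquad.exists_ne_common huv huw hvw) h
  exact hlt.not_ge (G.card_le_of_commonNeighbors hdeg hquad.card_le hindep)
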